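/- Let $\mathcal P=\{p_1,\dots,p_N\}$ ($N\ge 1$) be a finite set of pairwise disjoint (labelled) polygons in $\mathbb R^2$, called prototiles, where a polygon is the closed region enclosed by a simple closed polygonal line with finitely many designated vertices (vertices with a straight angle are allowed). For each $p\in\mathcal P$ fix a point $\mathbf x(p)$ in the interior of $p$, its puncture. A copy of $p$ is a tile $t=h(p)$ with $h$ an isometry of the plane (possibly orientation reversing); the label and the isometry $h$ are part of the data of the tile, and its puncture and its vertex set are $\mathbf x(t)=h(\mathbf x(p))$ and $\mathbf v(t)=h(\mathbf v(p))$, where $\mathbf v(p)$ is the set of vertices of $p$. Let $\omega$ be a substitution on $\mathcal P$ with scaling factor $\lambda>1$: for each $p\in\mathcal P$, $\omega(p)$ is a finite set of copies of prototiles with pairwise disjoint interiors whose union is $\lambda p$. Extend $\omega$ to copies $t=h(p)$ by letting $\omega(t)$ be the image of $\omega(p)$ under the isometry $x\mapsto \lambda h(\lambda^{-1}x)$, and to finite sets of copies by taking unions, so that $\omega$ can be iterated. Suppose that $\omega$ is primitive: there is $M\in\mathbb N$ such that $\omega^M(p)$ contains a copy of $q$ for all $p,q\in\mathcal P$. Let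 $X=\bigcup_{p\in\mathcal P}p$ and suppose that $X$ has Lebesgue measure $1$; let $m$ be Lebesgue measure on $X$. For $k\ge 0$ let $\mathcal T_k=\lambda^{-k}\omega^k(\mathcal P)$ be the set of tiles of level $k$ (the tiles of $\omega^k(\mathcal P)$ scaled by $\lambda^{-k}$, together with their punctures and vertices), let $\mathbf v(\mathcal T_k)=\bigcup_{t\in\mathcal T_k}\mathbf v(t)$, and define probability measures on $X$ by $$\xi_k=\frac1{|\mathcal T_k|}\sum_{t\in\mathcal T_k}\delta_{\mathbf x(t)},\qquad \rho_k=\frac1{\sum_{t\in\mathcal T_k}|\mathbf v(t)|}\sum_{t\in\mathcal T_k}\ \sum_{x\in\mathbf v(t)}\delta_x,\qquad \sigma_k=\frac1{|\mathbf v(\mathcal T_k)|}\sum_{x\in\mathbf v(\mathcal T_k)}\delta_x .$$ Then each of the sequences $(\xi_k)$, $(\rho_k)$ and $(\sigma_k)$ converges weak-$*$ to $m$ as $k\to\infty$. -/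

import Mathlib

open MeasureTheory Filter Topology
open scoped Pointwise ENNReal

noncomputable section

namespace PolygonSubstitution

/-- The Euclidean plane. -/
abbrev Plane : Type := EuclideanSpace ℝ (Fin 2)

/-- The closed polygonal line with vertices `p 0, …, p (n - 1)` is simple: it has at least three
vertices, they are distinct, and two different edges meet at most in a common endpoint.
(Straight angles at vertices are allowed.) -/
def IsSimple {n : ℕ} (p : Polygon Plane n) : Prop :=
  3 ≤ n ∧ Function.Injective p.vertices ∧
    ∀ i j : Fin n, i ≠ j →
      p.edgeSet ℝ i ∩ p.edgeSet ℝ j ⊆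
        {p i, p (finRotate n i)} ∩ {p j, p (finRotate n j)}

/-- `T` is the closed polygonal region enclosed by the simple closed polygonal line `p`: a compact
set that is the closure of its interior and whose topological boundary is `p`. -/
structure IsRegion {n : ℕ} (p : Polygon Plane n) (T : Set Plane) : Prop where
  isSimple : IsSimple p
  isCompact : IsCompact T
  closure_interior : closure (interior T) = T
  frontier_eq : frontier T = p.boundary ℝ

/-- A prototile: a (closed, simple) polygon in the plane with a distinguished interior point,
its puncture. -/
structure Prototile where
  /-- the number of vertices -/
  n : ℕ
  /-- the boundary line, that is, the vertices in cyclic order -/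
  poly : Polygon Plane n
  /-- the polygon as a set of points -/
  carrier : Set Plane
  isRegion : IsRegion poly carrier
  /-- the distinguished point -/
  puncture : Plane
  puncture_mem : puncture ∈ interior carrier

/-- A copy of a prototile: the label of the prototile together with an isometry of the plane (which
may reverse the orientation). -/
structure Tile (ι : Type*) where
  /-- the label of the prototile of which this is a copy -/
  label : ι
  /-- the isometry that moves the prototile to its copy -/
  iso : Plane ≃ᵃⁱ[ℝ] Plane

namespace Tile

variable {ι : Type*} (P : ι → Prototile) (t : Tile ι)

/-- The copy as a set of points. -/
def support : Set Plane := t.iso '' (P t.label).carrier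

/-- The puncture of the copy. -/
def puncture : Plane := t.iso (P t.label).puncture

open Classical in
/-- The set of vertices of the copy. -/
def vertices : Finset Plane := Finset.univ.image fun i => t.iso ((P t.label).poly i)

end Tile

/-- The isometry `x ↦ c h(c⁻¹ x)`: if `t = h(p)` then it carries `c p` to `c t`. -/
def conjScale (c : ℝ) (hc : c ≠ 0) (h : Plane ≃ᵃⁱ[ℝ] Plane) : Plane ≃ᵃⁱ[ℝ] Plane :=
  AffineIsometryEquiv.mk' (fun x => c • h (c⁻¹ • x)) h.linearIsometryEquiv 0 (by
    intro x
    have h1 := h.map_vadd (0 : Plane) (c⁻¹ • x)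
    simp only [vadd_eq_add, add_zero] at h1
    simp only [h1, smul_add, vsub_eq_sub, sub_zero, smul_zero, vadd_eq_add, map_smul,
      smul_inv_smul₀ hc])

@[simp] theorem conjScale_apply (c : ℝ) (hc : c ≠ 0) (h : Plane ≃ᵃⁱ[ℝ] Plane) (x : Plane) :
    conjScale c hc h x = c • h (c⁻¹ • x) := rfl

end PolygonSubstitution

open PolygonSubstitution

/-- A substitution with constant scaling factor on a finite set of pairwise disjoint polygonal
prototiles in the plane, labelled by `ι`. -/
structure PolygonSubstitution (ι : Type*) where
  /-- the prototiles -/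
  tile : ι → Prototile
  disjoint : Pairwise fun i j => Disjoint (tile i).carrier (tile j).carrier
  /-- the scaling factor -/
  scale : ℝ
  one_lt_scale : 1 < scale
  /-- the substitution rule: each prototile is sent to a finite set of copies of prototiles -/
  rule : ι → Finset (Tile ι)
  /-- the tiles of `rule i` have pairwise disjoint interiors -/
  interior_disjoint : ∀ i, ∀ s ∈ rule i, ∀ t ∈ rule i, s ≠ t →
    Disjoint (interior (s.support tile)) (interior (t.support tile))
  /-- the tiles of `rule i` cover exactly the prototile `i` magnified by `scale` -/
  iUnion_support : ∀ i, ⋃ t ∈ rule i, t.support tile = scale • (tile i).carrier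

namespace PolygonSubstitution

/-- The normalised sum of the point masses at the points of a finite nonempty family:
`(1 / |κ|) ∑ i, δ_{x i}`. -/
def averageDirac {κ α : Type*} [Fintype κ] [Nonempty κ] [MeasurableSpace α] (x : κ → α) :
    ProbabilityMeasure α :=
  ⟨(Fintype.card κ : ℝ≥0∞)⁻¹ • ∑ i, Measure.dirac (x i), ⟨by
    simp only [Measure.smul_apply, Measure.finsetSum_apply, measure_univ, Finset.sum_const,
      Finset.card_univ, nsmul_eq_mul, mul_one, smul_eq_mul]
    exact ENNReal.inv_mul_cancel (by simp) (by simp)⟩⟩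

variable {ι : Type*} (S : PolygonSubstitution ι)

theorem scale_ne_zero : S.scale ≠ 0 := (zero_lt_one.trans S.one_lt_scale).ne'

/-- The prototile `i`, as a tile. -/
def proto (i : ι) : Tile ι := ⟨i, AffineIsometryEquiv.refl ℝ Plane⟩

open Classical in
/-- The substitution applied to a tile `t = h(p)`: the image of the patch `ω(p)` under
`x ↦ λ h(λ⁻¹ x)`; it covers `λ t`. -/
def substTile (t : Tile ι) : Finset (Tile ι) :=
  (S.rule t.label).image fun s => ⟨s.label, s.iso.trans (conjScale S.scale S.scale_ne_zero t.iso)⟩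

open Classical in
/-- The substitution applied to a set of tiles, tile by tile. -/
def substPatch (Q : Finset (Tile ι)) : Finset (Tile ι) := Q.biUnion S.substTile

/-- Primitivity: for some `M`, the patch `ω^M(p)` contains a copy of `q` for all prototiles `p`
and `q`. -/
def IsPrimitive : Prop := ∃ M : ℕ, ∀ i j : ι, ∃ t ∈ S.substPatch^[M] {proto i}, t.label = j

/-- The space `X`, the union of the prototiles. -/
def X : Set Plane := ⋃ i, (S.tile i).carrier

theorem support_subset_of_mem_substTile {t s : Tile ι} (hs : s ∈ S.substTile t) :
    s.support S.tile ⊆ S.scale • t.support S.tile := by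
  classical
  obtain ⟨r, hr, rfl⟩ := Finset.mem_image.1 hs
  rintro _ ⟨x, hx, rfl⟩
  have h1 : r.iso x ∈ S.scale • (S.tile t.label).carrier := by
    rw [← S.iUnion_support]
    exact Set.mem_biUnion hr ⟨x, hx, rfl⟩
  obtain ⟨y, hy, hxy⟩ := h1
  refine ⟨t.iso y, ⟨y, hy, rfl⟩, ?_⟩
  simp only [] at hxy
  simp [← hxy, inv_smul_smul₀ S.scale_ne_zero]

theorem puncture_mem_support (t : Tile ι) : t.puncture S.tile ∈ t.support S.tile :=
  ⟨_, interior_subset (S.tile t.label).puncture_mem, rfl⟩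

theorem vertices_subset_support (t : Tile ι) {x : Plane} (hx : x ∈ t.vertices S.tile) :
    x ∈ t.support S.tile := by
  classical
  obtain ⟨i, -, rfl⟩ := Finset.mem_image.1 hx
  have hR := (S.tile t.label).isRegion
  refine ⟨_, hR.isCompact.isClosed.frontier_subset ?_, rfl⟩
  rw [hR.frontier_eq]
  exact Set.mem_iUnion.2 ⟨i, left_mem_affineSegment ℝ _ _⟩

theorem vertices_nonempty (t : Tile ι) : (t.vertices S.tile).Nonempty := by
  classical
  have h3 := (S.tile t.label).isRegion.isSimple.1
  exact Finset.Nonempty.image ⟨⟨0, by omega⟩, Finset.mem_univ _⟩ _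

variable [Fintype ι]

open Classical in
/-- The patch `ω^k(P)`, where `P` is the set of all prototiles. The tiles of level `k` are the tiles
of this patch scaled by `λ⁻ᵏ`. -/
def patch (k : ℕ) : Finset (Tile ι) := S.substPatch^[k] (Finset.univ.image proto)

theorem support_subset_of_mem_patch (k : ℕ) {t : Tile ι} (ht : t ∈ S.patch k) :
    t.support S.tile ⊆ S.scale ^ k • S.X := by
  classical
  induction k generalizing t with
  | zero =>
    obtain ⟨i, -, rfl⟩ := Finset.mem_image.1 ht
    rintro _ ⟨x, hx, rfl⟩
    simpa [X] using ⟨i, hx⟩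
  | succ k ih =>
    rw [patch, Function.iterate_succ_apply'] at ht
    obtain ⟨s, hs, hts⟩ := Finset.mem_biUnion.1 ht
    refine (S.support_subset_of_mem_substTile hts).trans ?_
    rw [pow_succ', mul_smul]
    exact Set.smul_set_mono (ih hs)

theorem inv_smul_mem (k : ℕ) {t : Tile ι} (ht : t ∈ S.patch k) {x : Plane}
    (hx : x ∈ t.support S.tile) : (S.scale ^ k)⁻¹ • x ∈ S.X :=
  (Set.mem_smul_set_iff_inv_smul_mem₀ (pow_ne_zero k S.scale_ne_zero) _ _).1
    (S.support_subset_of_mem_patch k ht hx)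

theorem patch_nonempty [Nonempty ι] (k : ℕ) : (S.patch k).Nonempty := by
  classical
  induction k with
  | zero => exact Finset.Nonempty.image Finset.univ_nonempty _
  | succ k ih =>
    rw [patch, Function.iterate_succ_apply']
    obtain ⟨t, ht⟩ := ih
    refine Finset.Nonempty.biUnion ⟨t, ht⟩ fun s _ => Finset.Nonempty.image ?_ _
    by_contra h
    have h1 := S.iUnion_support s.label
    rw [Finset.not_nonempty_iff_eq_empty.1 h] at h1
    have h2 : S.scale • (S.tile s.label).puncture ∈ S.scale • (S.tile s.label).carrier :=
      Set.smul_mem_smul_set (interior_subset (S.tile s.label).puncture_mem)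
    simp [← h1] at h2

/-- The puncture of a tile of level `k`, as a point of `X`. -/
def levelPuncture (k : ℕ) (t : S.patch k) : S.X :=
  ⟨(S.scale ^ k)⁻¹ • t.1.puncture S.tile, S.inv_smul_mem k t.2 (S.puncture_mem_support t.1)⟩

/-- A vertex of a tile of level `k`, as a point of `X`. -/
def levelVertex (k : ℕ) (v : (t : S.patch k) × (t.1.vertices S.tile)) : S.X :=
  ⟨(S.scale ^ k)⁻¹ • (v.2 : Plane), S.inv_smul_mem k v.1.2 (S.vertices_subset_support v.1.1 v.2.2)⟩

open Classical in
/-- The set of all vertices of tiles of level `k`, each counted once. -/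
def levelVertices (k : ℕ) : Finset S.X := Finset.univ.image (S.levelVertex k)

instance [Nonempty ι] (k : ℕ) : Nonempty (S.patch k) := (S.patch_nonempty k).to_subtype

instance [Nonempty ι] (k : ℕ) : Nonempty ((t : S.patch k) × (t.1.vertices S.tile)) :=
  let t : S.patch k := Classical.arbitrary _
  ⟨⟨t, ⟨_, (S.vertices_nonempty t.1).choose_spec⟩⟩⟩

instance [Nonempty ι] (k : ℕ) : Nonempty (S.levelVertices k) :=
  (Finset.Nonempty.image Finset.univ_nonempty _).to_subtype

/-- `ξ_k`: equal point masses at the punctures of the tiles of level `k`. -/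
def xi [Nonempty ι] (k : ℕ) : ProbabilityMeasure S.X := averageDirac (S.levelPuncture k)

/-- `ρ_k`: a point mass for each pair of a tile of level `k` and a vertex of that tile. -/
def rho [Nonempty ι] (k : ℕ) : ProbabilityMeasure S.X := averageDirac (S.levelVertex k)

/-- `σ_k`: a point mass for each distinct vertex of tiles of level `k`. -/
def sigma [Nonempty ι] (k : ℕ) : ProbabilityMeasure S.X :=
  averageDirac fun x : S.levelVertices k => (x : S.X)

theorem measurableSet_X : MeasurableSet S.X :=
  MeasurableSet.iUnion fun i => (S.tile i).isRegion.isCompact.isClosed.measurableSet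

/-- Lebesgue measure on `X`, when `X` has area one. -/
def lebesgue (hX : volume S.X = 1) : ProbabilityMeasure S.X :=
  ⟨Measure.comap (Subtype.val : S.X → Plane) volume, ⟨by
    rw [comap_subtype_coe_apply S.measurableSet_X]
    simpa using hX⟩⟩

end PolygonSubstitution

end

/-! Fix a level `n`. A tile `s` of that level contains, `k` levels later, a number of points that
depends only on `k` and the label of `s`. If this number is asymptotically a constant times `λ^(2k)`
times the area of `s`, with the same constant for all labels, then the proportion of points in any
union of level-`n` tiles tends to its area. Such unions fill open sets from inside, so the
portmanteau theorem gives weak convergence (`tendsto_averageDirac`).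

The common constant comes from `exists_tendsto_of_subadditive`, an elementary substitute for
Perron-Frobenius theory. Divide the count by the area of the inflated prototile. The maximum over
labels of these densities is nonincreasing in `k`, because area is additive under subdivision. By
primitivity, a density lagging behind the maximum pulls down all densities `M` levels later, so
every density converges to the limit of the maximum. Only subadditivity of the count is used.

For `ξ` and `ρ` the counts are additive. For `σ`, vertices shared by tiles break additivity:
counting all vertices is subadditive, counting those interior to each inflated tile bounds from
below, and the two differ by `o(λ^(2k))` since polygon boundaries are null sets. -/

namespace PolygonSubstitution

/-! ### Isometries, areas and null boundaries. -/

theorem measurePreserving_affineIsometry (h : Plane ≃ᵃⁱ[ℝ] Plane) : MeasurePreserving h := by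
  have h1 := (measurePreserving_add_right (volume : Measure Plane) (h 0)).comp
    h.linearIsometryEquiv.measurePreserving
  have h2 : (fun x => x + h 0) ∘ h.linearIsometryEquiv = h := by
    funext x
    simpa using (h.map_vadd 0 x).symm
  rwa [h2] at h1

theorem volume_image_affineIsometry (h : Plane ≃ᵃⁱ[ℝ] Plane) (A : Set Plane) :
    volume (h '' A) = volume A := by
  have h1 : h '' A = h.symm ⁻¹' A := h.toEquiv.image_eq_preimage_symm A
  rw [h1]
  exact (measurePreserving_affineIsometry h.symm).measure_preimage_emb
    h.symm.toHomeomorph.measurableEmbedding A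

theorem image_interior_affineIsometry (h : Plane ≃ᵃⁱ[ℝ] Plane) (A : Set Plane) :
    h '' interior A = interior (h '' A) := h.toHomeomorph.image_interior A

theorem image_frontier_affineIsometry (h : Plane ≃ᵃⁱ[ℝ] Plane) (A : Set Plane) :
    h '' frontier A = frontier (h '' A) := h.toHomeomorph.image_frontier A

theorem volume_affineSegment (x y : Plane) : volume (affineSegment ℝ x y) = 0 := by
  have h1 : affineSegment ℝ x y ⊆ (line[ℝ, x, y] : AffineSubspace ℝ Plane) := by
    rintro _ ⟨c, -, rfl⟩
    exact AffineMap.lineMap_mem_affineSpan_pair c x y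
  refine measure_mono_null h1 (Measure.addHaar_affineSubspace _ _ fun h => ?_)
  have h2 := collinear_iff_finrank_le_one.1 (collinear_pair ℝ x y)
  rw [← direction_affineSpan, h, AffineSubspace.direction_top, finrank_top] at h2
  simp at h2

theorem Prototile.volume_frontier (p : Prototile) : volume (frontier p.carrier) = 0 := by
  rw [p.isRegion.frontier_eq]
  exact measure_iUnion_null fun i => volume_affineSegment _ _

/-- Conjugation by a scaling respects composition; this makes the substitution equivariant under
isometries. -/
theorem conjScale_trans (c : ℝ) (hc : c ≠ 0) (g h : Plane ≃ᵃⁱ[ℝ] Plane) :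
    conjScale c hc (g.trans h) = (conjScale c hc g).trans (conjScale c hc h) := by
  ext x
  simp [inv_smul_smul₀ hc]

namespace Tile

variable {ι : Type*} (P : ι → Prototile) (t : Tile ι)

theorem isCompact_support : IsCompact (t.support P) :=
  (P t.label).isRegion.isCompact.image t.iso.continuous

theorem volume_support : volume (t.support P) = volume (P t.label).carrier :=
  volume_image_affineIsometry _ _

theorem interior_support : interior (t.support P) = t.iso '' interior (P t.label).carrier :=
  (image_interior_affineIsometry _ _).symm

theorem interior_support_nonempty : (interior (t.support P)).Nonempty := by
  rw [interior_support]
  exact ⟨_, _, (P t.label).puncture_mem, rfl⟩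

theorem volume_frontier_support : volume (frontier (t.support P)) = 0 := by
  rw [support, ← image_frontier_affineIsometry, volume_image_affineIsometry,
    Prototile.volume_frontier]

/-- The image of a tile under an isometry of the plane. -/
noncomputable def map (g : Plane ≃ᵃⁱ[ℝ] Plane) (t : Tile ι) : Tile ι := ⟨t.label, t.iso.trans g⟩

theorem map_injective (g : Plane ≃ᵃⁱ[ℝ] Plane) : Function.Injective (map (ι := ι) g) := by
  rintro ⟨i, h⟩ ⟨j, h'⟩ hs
  simp only [map, Tile.mk.injEq] at hs ⊢
  refine ⟨hs.1, ?_⟩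
  ext1 x
  have h2 := congrArg (fun f : Plane ≃ᵃⁱ[ℝ] Plane => f x) hs.2
  exact g.injective h2

@[simp] theorem map_label (g : Plane ≃ᵃⁱ[ℝ] Plane) : (t.map g).label = t.label := rfl

theorem map_support (g : Plane ≃ᵃⁱ[ℝ] Plane) :
    (t.map g).support P = g '' t.support P := by
  simp [support, map, Set.image_image]

theorem map_proto : (proto t.label).map t.iso = t := by
  cases t
  simp only [map, proto, Tile.mk.injEq, true_and]
  ext1 x
  rfl

open Classical in
theorem map_vertices (g : Plane ≃ᵃⁱ[ℝ] Plane) :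
    (t.map g).vertices P = (t.vertices P).image g := by
  simp only [vertices, map, Finset.image_image]
  rfl

theorem card_vertices : (t.vertices P).card = (P t.label).n := by
  classical
  have h1 : Function.Injective fun i => t.iso ((P t.label).poly i) :=
    t.iso.injective.comp (P t.label).isRegion.isSimple.2.1
  rw [vertices, Finset.card_image_of_injective _ h1]
  simp

theorem proto_support (i : ι) : (proto i).support P = (P i).carrier := by
  simp [support, proto]

end Tile

/-! ### Packings, covers and iterated substitution. -/

variable {ι : Type*} (S : PolygonSubstitution ι)

theorem scale_pos : 0 < S.scale := zero_lt_one.trans S.one_lt_scale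

/-- The union of the tiles of a patch. -/
def cover (Q : Finset (Tile ι)) : Set Plane := ⋃ t ∈ Q, t.support S.tile

/-- The tiles of the patch have pairwise disjoint interiors. -/
def IsPacking (Q : Finset (Tile ι)) : Prop :=
  (Q : Set (Tile ι)).PairwiseDisjoint fun t => interior (t.support S.tile)

theorem support_subset_cover {Q : Finset (Tile ι)} {t : Tile ι} (ht : t ∈ Q) :
    t.support S.tile ⊆ S.cover Q :=
  Set.subset_biUnion_of_mem (u := fun t : Tile ι => t.support S.tile) ht

@[simp] theorem cover_singleton (t : Tile ι) : S.cover {t} = t.support S.tile := by simp [cover]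

open Classical in
theorem cover_image_map (g : Plane ≃ᵃⁱ[ℝ] Plane) (Q : Finset (Tile ι)) :
    S.cover (Q.image (Tile.map g)) = g '' S.cover Q := by
  simp [cover, Set.image_iUnion₂, Tile.map_support]

theorem IsPacking.subset {Q R : Finset (Tile ι)} (hQ : S.IsPacking Q) (h : R ⊆ Q) :
    S.IsPacking R :=
  Set.PairwiseDisjoint.subset hQ (by exact_mod_cast h)

/-- Tiles of a packing can share boundary points, but their overlaps lie in frontiers, which are
null; almost-everywhere disjointness suffices for additivity. -/
theorem volume_cover {Q : Finset (Tile ι)} (hQ : S.IsPacking Q) :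
    volume (S.cover Q) = ∑ t ∈ Q, volume (S.tile t.label).carrier := by
  rw [cover, measure_biUnion_finset₀]
  · exact Finset.sum_congr rfl fun t _ => t.volume_support S.tile
  · intro s hs t ht hst
    refine measure_mono_null (t := frontier (s.support S.tile) ∪ frontier (t.support S.tile)) ?_
      (measure_union_null (s.volume_frontier_support _) (t.volume_frontier_support _))
    rintro x ⟨hxs, hxt⟩
    by_contra hx
    rw [(s.isCompact_support _).isClosed.frontier_eq, (t.isCompact_support _).isClosed.frontier_eq]
      at hx
    have h1 : x ∈ interior (s.support S.tile) ∧ x ∈ interior (t.support S.tile) := by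
      simp only [Set.mem_union, Set.mem_sdiff, hxs, hxt, true_and] at hx
      tauto
    exact Set.disjoint_left.1 (hQ hs ht hst) h1.1 h1.2
  · exact fun t _ => (t.isCompact_support _).isClosed.measurableSet.nullMeasurableSet

/-- The area of a prototile. -/
noncomputable def area (i : ι) : ℝ := volume.real (S.tile i).carrier

theorem area_pos (i : ι) : 0 < S.area i := by
  refine ENNReal.toReal_pos ?_ (S.tile i).isRegion.isCompact.measure_lt_top.ne
  refine ne_of_gt (lt_of_lt_of_le ?_ (measure_mono interior_subset))
  exact isOpen_interior.measure_pos _ ⟨_, (S.tile i).puncture_mem⟩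

theorem volumeReal_cover {Q : Finset (Tile ι)} (hQ : S.IsPacking Q) :
    volume.real (S.cover Q) = ∑ t ∈ Q, S.area t.label := by
  rw [Measure.real, S.volume_cover hQ, ENNReal.toReal_sum]
  · rfl
  · exact fun t _ => (S.tile t.label).isRegion.isCompact.measure_lt_top.ne

theorem volumeReal_smul (c : ℝ) (A : Set Plane) : volume.real (c • A) = c ^ 2 * volume.real A := by
  rw [Measure.real, Measure.addHaar_smul, ENNReal.toReal_mul]
  simp [Measure.real, sq_nonneg]

theorem substTile_eq_image_map [DecidableEq (Tile ι)] (t : Tile ι) :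
    S.substTile t = (S.rule t.label).image
      (Tile.map (conjScale S.scale S.scale_ne_zero t.iso)) := by
  ext; simp [substTile, Tile.map]

theorem substTile_map [DecidableEq (Tile ι)] (g : Plane ≃ᵃⁱ[ℝ] Plane) (t : Tile ι) :
    S.substTile (t.map g) =
      (S.substTile t).image (Tile.map (conjScale S.scale S.scale_ne_zero g)) := by
  simp only [substTile_eq_image_map, Finset.image_image]
  refine Finset.image_congr fun s _ => ?_
  simp only [Tile.map, conjScale_trans, Function.comp, Tile.mk.injEq, true_and]
  ext1 x
  rfl

theorem substPatch_map [DecidableEq (Tile ι)] (g : Plane ≃ᵃⁱ[ℝ] Plane) (Q : Finset (Tile ι)) :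
    S.substPatch (Q.image (Tile.map g)) =
      (S.substPatch Q).image (Tile.map (conjScale S.scale S.scale_ne_zero g)) := by
  ext s
  simp only [substPatch, Finset.mem_biUnion, Finset.mem_image]
  constructor
  · rintro ⟨_, ⟨t, ht, rfl⟩, hs⟩
    rw [substTile_map, Finset.mem_image] at hs
    obtain ⟨r, hr, rfl⟩ := hs
    exact ⟨r, ⟨t, ht, hr⟩, rfl⟩
  · rintro ⟨r, ⟨t, ht, hr⟩, rfl⟩
    refine ⟨_, ⟨t, ht, rfl⟩, ?_⟩
    rw [substTile_map]
    exact Finset.mem_image_of_mem _ hr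

theorem cover_substTile (t : Tile ι) : S.cover (S.substTile t) = S.scale • t.support S.tile := by
  classical
  rw [substTile_eq_image_map, cover_image_map, cover, S.iUnion_support]
  ext x
  simp only [Set.mem_image, Set.mem_smul_set, Tile.support, conjScale_apply]
  constructor
  · rintro ⟨_, ⟨y, hy, rfl⟩, rfl⟩
    exact ⟨_, ⟨y, hy, rfl⟩, by rw [inv_smul_smul₀ S.scale_ne_zero]⟩
  · rintro ⟨_, ⟨y, hy, rfl⟩, rfl⟩
    exact ⟨_, ⟨y, hy, rfl⟩, by rw [inv_smul_smul₀ S.scale_ne_zero]⟩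

theorem isPacking_substTile (t : Tile ι) : S.IsPacking (S.substTile t) := by
  classical
  rw [substTile_eq_image_map]
  rintro _ hs _ ht hst
  rw [Finset.mem_coe, Finset.mem_image] at hs ht
  obtain ⟨s, hs, rfl⟩ := hs
  obtain ⟨r, hr, rfl⟩ := ht
  have h1 := S.interior_disjoint _ s hs r hr fun h => hst (h ▸ rfl)
  simp only [Function.onFun, Tile.map_support, ← image_interior_affineIsometry]
  exact (Set.disjoint_image_iff (AffineIsometryEquiv.injective _)).2 h1

theorem cover_substPatch (Q : Finset (Tile ι)) :
    S.cover (S.substPatch Q) = S.scale • S.cover Q := by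
  classical
  rw [cover, substPatch, Finset.set_biUnion_biUnion, cover, Set.smul_set_iUnion₂]
  simp_rw [← cover_substTile]
  rfl

/-- Two tiles from the same inflated tile are separated by the substitution rule, and tiles from
different inflated tiles by the packing `Q`, scaled. -/
theorem IsPacking.substPatch {Q : Finset (Tile ι)} (hQ : S.IsPacking Q) :
    S.IsPacking (S.substPatch Q) := by
  classical
  intro s hs r hr hsr
  simp only [PolygonSubstitution.substPatch, Finset.coe_biUnion, Set.mem_iUnion,
    Finset.mem_coe, exists_prop] at hs hr
  obtain ⟨t, ht, hs⟩ := hs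
  obtain ⟨u, hu, hr⟩ := hr
  rcases eq_or_ne t u with rfl | htu
  · exact S.isPacking_substTile t hs hr hsr
  · have h1 := hQ ht hu htu
    have h2 : Disjoint (S.scale • interior (t.support S.tile))
        (S.scale • interior (u.support S.tile)) :=
      (Set.disjoint_image_iff (smul_right_injective _ S.scale_ne_zero)).2 h1
    rw [← interior_smul₀ S.scale_ne_zero, ← interior_smul₀ S.scale_ne_zero] at h2
    exact h2.mono (interior_mono (S.support_subset_of_mem_substTile hs))
      (interior_mono (S.support_subset_of_mem_substTile hr))

/-- The patch `ω^k(t)`. -/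
noncomputable def superTile (k : ℕ) (t : Tile ι) : Finset (Tile ι) := S.substPatch^[k] {t}

theorem cover_iterate (k : ℕ) (Q : Finset (Tile ι)) :
    S.cover (S.substPatch^[k] Q) = S.scale ^ k • S.cover Q := by
  induction k with
  | zero => simp
  | succ k ih => rw [Function.iterate_succ_apply', cover_substPatch, ih, pow_succ', mul_smul]

theorem IsPacking.iterate {Q : Finset (Tile ι)} (hQ : S.IsPacking Q) (k : ℕ) :
    S.IsPacking (S.substPatch^[k] Q) := by
  induction k with
  | zero => exact hQ
  | succ k ih => rw [Function.iterate_succ_apply']; exact ih.substPatch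

theorem isPacking_singleton (t : Tile ι) : S.IsPacking {t} := by
  simp [IsPacking]

theorem isPacking_superTile (k : ℕ) (t : Tile ι) : S.IsPacking (S.superTile k t) :=
  (S.isPacking_singleton t).iterate S k

theorem cover_superTile (k : ℕ) (t : Tile ι) :
    S.cover (S.superTile k t) = S.scale ^ k • t.support S.tile := by
  rw [superTile, cover_iterate, cover_singleton]

theorem support_subset_of_mem_superTile {k : ℕ} {s t : Tile ι} (hs : s ∈ S.superTile k t) :
    s.support S.tile ⊆ S.scale ^ k • t.support S.tile :=
  S.cover_superTile k t ▸ S.support_subset_cover hs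

theorem iterate_eq_biUnion [DecidableEq (Tile ι)] (k : ℕ) (Q : Finset (Tile ι)) :
    S.substPatch^[k] Q = Q.biUnion (S.superTile k) := by
  induction k with
  | zero =>
    ext s
    simp [superTile]
  | succ k ih =>
    rw [Function.iterate_succ_apply', ih]
    ext s
    simp only [superTile, Function.iterate_succ_apply', substPatch, Finset.mem_biUnion]
    grind

theorem superTile_add [DecidableEq (Tile ι)] (n k : ℕ) (t : Tile ι) :
    S.superTile (n + k) t = (S.superTile n t).biUnion (S.superTile k) := by
  rw [← iterate_eq_biUnion, superTile, superTile, add_comm, Function.iterate_add_apply]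

theorem iterate_map [DecidableEq (Tile ι)] (k : ℕ) (g : Plane ≃ᵃⁱ[ℝ] Plane) :
    ∃ g' : Plane ≃ᵃⁱ[ℝ] Plane, ∀ Q : Finset (Tile ι),
      S.substPatch^[k] (Q.image (Tile.map g)) = (S.substPatch^[k] Q).image (Tile.map g') := by
  induction k with
  | zero => exact ⟨g, fun Q => rfl⟩
  | succ k ih =>
    obtain ⟨g', hg⟩ := ih
    -- Each further substitution conjugates the isometry by the scaling once more.
    refine ⟨conjScale S.scale S.scale_ne_zero g', fun Q => ?_⟩
    rw [Function.iterate_succ_apply', hg, substPatch_map, Function.iterate_succ_apply']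

/-- Consequently every isometry-invariant count on `ω^k(t)` depends only on `k` and the label of
`t`. -/
theorem exists_superTile_eq_image [DecidableEq (Tile ι)] (k : ℕ) (t : Tile ι) :
    ∃ g : Plane ≃ᵃⁱ[ℝ] Plane,
      S.superTile k t = (S.superTile k (proto t.label)).image (Tile.map g) := by
  obtain ⟨g, hg⟩ := S.iterate_map k t.iso
  refine ⟨g, ?_⟩
  have h1 := hg {proto t.label}
  rwa [Finset.image_singleton, Tile.map_proto] at h1

/-- Inflated tiles of a packing have no tile in common. -/
theorem IsPacking.pairwiseDisjoint_superTile {Q : Finset (Tile ι)} (hQ : S.IsPacking Q) (k : ℕ) :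
    (Q : Set (Tile ι)).PairwiseDisjoint (S.superTile k) := by
  intro s hs t ht hst
  rw [Function.onFun, Finset.disjoint_left]
  intro r hr hr'
  -- An interior point of a common tile, scaled back, would be interior to both `s` and `t`.
  obtain ⟨x, hx⟩ := r.interior_support_nonempty S.tile
  have h1 := interior_mono (S.support_subset_of_mem_superTile hr) hx
  have h2 := interior_mono (S.support_subset_of_mem_superTile hr') hx
  have hk := pow_ne_zero k S.scale_ne_zero
  rw [interior_smul₀ hk, Set.mem_smul_set_iff_inv_smul_mem₀ hk] at h1 h2
  exact Set.disjoint_left.1 (hQ hs ht hst) h1 h2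

/-- The areas form a positive eigenvector, with eigenvalue `λ²`, of the substitution matrix. -/
theorem sum_area_superTile (k : ℕ) (t : Tile ι) :
    ∑ s ∈ S.superTile k t, S.area s.label = (S.scale ^ k) ^ 2 * S.area t.label := by
  rw [← S.volumeReal_cover (S.isPacking_superTile k t), cover_superTile, volumeReal_smul,
    Measure.real, Tile.volume_support]
  rfl

/-! ### The patches `ω^k(P)`. -/

section Patch

variable [Fintype ι]

theorem isPacking_patch (k : ℕ) : S.IsPacking (S.patch k) := by
  classical
  refine IsPacking.iterate S ?_ k
  rintro _ hs _ ht hst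
  rw [Finset.mem_coe, Finset.mem_image] at hs ht
  obtain ⟨i, -, rfl⟩ := hs
  obtain ⟨j, -, rfl⟩ := ht
  have hij : i ≠ j := fun h => hst (h ▸ rfl)
  simp only [Function.onFun, Tile.proto_support]
  exact (S.disjoint hij).mono interior_subset interior_subset

theorem cover_patch (k : ℕ) : S.cover (S.patch k) = S.scale ^ k • S.X := by
  classical
  rw [patch, cover_iterate]
  congr 1
  simp [cover, X, Tile.proto_support]

theorem patch_add [DecidableEq (Tile ι)] (n k : ℕ) :
    S.patch (n + k) = (S.patch n).biUnion (S.superTile k) := by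
  rw [← iterate_eq_biUnion, patch, patch, add_comm, Function.iterate_add_apply]

theorem patch_eq_biUnion [DecidableEq (Tile ι)] (k : ℕ) :
    S.patch k = Finset.univ.biUnion fun i => S.superTile k (proto i) := by
  classical
  rw [patch, iterate_eq_biUnion]
  ext s
  simp

theorem sum_area (hX : volume S.X = 1) : ∑ i, S.area i = 1 := by
  have h1 : volume.real S.X = 1 := by simp [Measure.real, hX]
  rw [← h1, X, measureReal_iUnion_fintype S.disjoint
    (fun i => (S.tile i).isRegion.isCompact.isClosed.measurableSet)
    (fun i => (S.tile i).isRegion.isCompact.measure_lt_top.ne)]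
  rfl

end Patch

end PolygonSubstitution

/-! ### Growth of subadditive counts and the equidistribution criterion. -/

namespace PolygonSubstitution

variable {ι : Type*} (S : PolygonSubstitution ι)

theorem averageDirac_apply {κ α : Type*} [Fintype κ] [Nonempty κ] [MeasurableSpace α] (x : κ → α)
    {G : Set α} (hG : MeasurableSet G) [DecidablePred fun a => x a ∈ G] :
    (averageDirac x : Measure α) G =
      ENNReal.ofReal ((Finset.univ.filter fun a => x a ∈ G).card / Fintype.card κ) := by
  have h1 : (averageDirac x : Measure α) G =
      (Fintype.card κ : ℝ≥0∞)⁻¹ * ∑ a, Measure.dirac (x a) G := by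
    simp [averageDirac]
  rw [h1, ENNReal.ofReal_div_of_pos (by exact_mod_cast Fintype.card_pos), ENNReal.ofReal_natCast,
    ENNReal.ofReal_natCast, mul_comm, ENNReal.div_eq_inv_mul, mul_comm]
  congr 1
  rw [Finset.card_filter]
  push_cast
  refine Finset.sum_congr rfl fun a _ => ?_
  rw [Measure.dirac_apply' _ hG]
  simp [Set.indicator_apply]

theorem sq_scale_pow_pos (k : ℕ) : 0 < (S.scale ^ k) ^ 2 := pow_pos (pow_pos S.scale_pos k) 2

theorem exists_div_scale_pow_lt (D : ℝ) {δ : ℝ} (hδ : 0 < δ) :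
    ∃ n : ℕ, D / S.scale ^ n < δ := by
  have h1 : Tendsto (fun n : ℕ => D / S.scale ^ n) atTop (𝓝 0) :=
    (tendsto_pow_atTop_atTop_of_one_lt S.one_lt_scale).const_div_atTop D
  exact (h1.eventually_lt_const hδ).exists

variable [Fintype ι] [Nonempty ι]

/-- A nonnegative quantity that is subadditive under subdivision grows, on the inflated prototile
`i`, like a constant times the area. -/
theorem exists_tendsto_of_subadditive (hprim : S.IsPrimitive) {N : ℕ → ι → ℝ}
    (hN : ∀ k i, 0 ≤ N k i)
    (hsub : ∀ n k i, N (n + k) i ≤ ∑ t ∈ S.superTile n (proto i), N k t.label) :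
    ∃ c : ℝ, ∀ i, Tendsto (fun k => N k i / (S.scale ^ k) ^ 2) atTop (𝓝 (c * S.area i)) := by
  classical
  obtain ⟨m, hm⟩ := hprim
  -- The density: count per unit area of the inflated prototile.
  set x : ℕ → ι → ℝ := fun k i => N k i / ((S.scale ^ k) ^ 2 * S.area i) with hx
  have hden : ∀ k i, 0 < (S.scale ^ k) ^ 2 * S.area i := fun k i =>
    mul_pos (S.sq_scale_pow_pos k) (S.area_pos i)
  have hNx : ∀ k i, N k i = x k i * ((S.scale ^ k) ^ 2 * S.area i) := fun k i =>
    (div_mul_cancel₀ _ (hden k i).ne').symm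
  have hx0 : ∀ k i, 0 ≤ x k i := fun k i => div_nonneg (hN k i) (hden k i).le
  set M : ℕ → ℝ := fun k => Finset.univ.sup' Finset.univ_nonempty (x k) with hM
  have hxM : ∀ k i, x k i ≤ M k := fun k i => Finset.le_sup' (x k) (Finset.mem_univ i)
  have hM0 : ∀ k, 0 ≤ M k := fun k => (hx0 k (Classical.arbitrary ι)).trans (hxM k _)
  have hpow : ∀ n k : ℕ, (S.scale ^ (n + k)) ^ 2 = (S.scale ^ n) ^ 2 * (S.scale ^ k) ^ 2 :=
    fun n k => by ring
  have hstep : ∀ n k i, x (n + k) i ≤ M k := by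
    intro n k i
    rw [hx, div_le_iff₀ (hden _ i), hpow]
    calc N (n + k) i ≤ ∑ t ∈ S.superTile n (proto i), N k t.label := hsub n k i
      _ ≤ ∑ t ∈ S.superTile n (proto i), (M k * (S.scale ^ k) ^ 2) * S.area t.label := by
        refine Finset.sum_le_sum fun t _ => ?_
        rw [hNx, mul_assoc]
        exact mul_le_mul_of_nonneg_right (hxM k _) (hden _ _).le
      _ = _ := by
        rw [← Finset.mul_sum, S.sum_area_superTile]
        simp only [proto]
        ring
  have hanti : Antitone M := by
    intro a b hab
    obtain ⟨n, rfl⟩ := Nat.exists_eq_add_of_le' hab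
    exact Finset.sup'_le _ _ fun i _ => hstep n a i
  have hlim := tendsto_atTop_ciInf hanti ⟨0, by rintro _ ⟨k, rfl⟩; exact hM0 k⟩
  set c := ⨅ k, M k
  -- `δ` is the least share of the area of an `m`-fold inflated prototile that one tile can occupy.
  obtain ⟨δ, hδ, hδ'⟩ : ∃ δ : ℝ, 0 < δ ∧
      ∀ i j, δ * ((S.scale ^ m) ^ 2 * S.area i) ≤ S.area j := by
    obtain ⟨q, hq⟩ := Finite.exists_min
      fun p : ι × ι => S.area p.2 / ((S.scale ^ m) ^ 2 * S.area p.1)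
    exact ⟨_, div_pos (S.area_pos q.2) (hden m q.1), fun i j =>
      (le_div_iff₀ (hden m i)).1 (hq (i, j))⟩
  -- Some tile of `ω^m(i)` has label `j`. Its shortfall from the density `M k` is kept, the other
  -- nonnegative shortfalls are dropped, and its share of the area is at least `δ`.
  have hcontract : ∀ k i j, x (m + k) i ≤ M k - δ * (M k - x k j) := by
    intro k i j
    obtain ⟨t, ht, htj⟩ := hm i j
    rw [hx, div_le_iff₀ (hden _ i), hpow]
    have h1 : ∑ s ∈ S.superTile m (proto i), (M k * (S.scale ^ k) ^ 2 * S.area s.label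
        - N k s.label) ≥ M k * (S.scale ^ k) ^ 2 * S.area j - N k j := by
      rw [← htj]
      refine Finset.single_le_sum (f := fun s : Tile ι => M k * (S.scale ^ k) ^ 2 * S.area s.label
        - N k s.label) (fun s _ => ?_) ht
      rw [hNx k s.label, mul_assoc, sub_nonneg]
      exact mul_le_mul_of_nonneg_right (hxM k _) (hden _ _).le
    rw [Finset.sum_sub_distrib, ← Finset.mul_sum, S.sum_area_superTile] at h1
    simp only [proto] at h1
    have h2 := hsub m k i
    simp only [proto] at h2
    have h3 : (M k - x k j) * (S.scale ^ k) ^ 2 * (δ * ((S.scale ^ m) ^ 2 * S.area i)) ≤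
        (M k - x k j) * (S.scale ^ k) ^ 2 * S.area j :=
      mul_le_mul_of_nonneg_left (hδ' i j)
        (mul_nonneg (sub_nonneg.2 (hxM k j)) (S.sq_scale_pow_pos k).le)
    have h4 := hNx k j
    change N (m + k) i ≤ (M k - δ * (M k - x k j)) * _
    nlinarith
  have hcontract' : ∀ k j, M (m + k) ≤ M k - δ * (M k - x k j) := fun k j =>
    Finset.sup'_le _ _ fun i _ => hcontract k i j
  refine ⟨c, fun i => ?_⟩
  have hlim' : Tendsto (fun k => M (m + k)) atTop (𝓝 c) := by
    simpa only [add_comm m] using (tendsto_add_atTop_iff_nat m).2 hlim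
  have hxlim : Tendsto (fun k => x k i) atTop (𝓝 c) := by
    refine tendsto_of_tendsto_of_tendsto_of_le_of_le
      -- The contraction bounds the gap `M k - x k i` by a multiple of `M k - M (m + k)`, which
      -- tends to zero.
      (g := fun k => M k - (M k - M (m + k)) / δ) ?_ hlim (fun k => ?_) (fun k => hxM k i)
    · have h1 := hlim.sub ((hlim.sub hlim').div_const δ)
      simpa using h1
    · have h1 := hcontract' k i
      have h2 : M k - x k i ≤ (M k - M (m + k)) / δ := by
        rw [le_div_iff₀ hδ]
        linarith
      simp only
      linarith
  refine (hxlim.mul_const (S.area i)).congr fun k => ?_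
  have h1 := (S.sq_scale_pow_pos k).ne'
  have h2 := (S.area_pos i).ne'
  simp only [hx]
  field_simp

/-- A common bound for the diameters of the tiles. -/
theorem exists_dist_le : ∃ D : ℝ, ∀ (t : Tile ι), ∀ x ∈ t.support S.tile, ∀ y ∈ t.support S.tile,
    dist x y ≤ D := by
  obtain ⟨i, hi⟩ := Finite.exists_max fun i => Metric.diam (S.tile i).carrier
  refine ⟨Metric.diam (S.tile i).carrier, ?_⟩
  rintro t _ ⟨x, hx, rfl⟩ _ ⟨y, hy, rfl⟩
  rw [t.iso.dist_map]
  exact (Metric.dist_le_diam_of_mem (S.tile t.label).isRegion.isCompact.isBounded hx hy).trans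
    (hi t.label)

/-- If every tile of level `k` carries one of the points `x k`, then their number is at least
of the order of `λ^(2k)`. -/
theorem exists_card_lower_bound (hX : volume S.X = 1) {κ : ℕ → Type*} [∀ k, Fintype (κ k)]
    (x : ∀ k, κ k → S.X)
    (hcov : ∀ k, ∀ t ∈ S.patch k, ∃ a, S.scale ^ k • (x k a : Plane) ∈ t.support S.tile) :
    ∃ η : ℝ, 0 < η ∧ ∀ k, η * (S.scale ^ k) ^ 2 ≤ Fintype.card (κ k) := by
  obtain ⟨D, hD⟩ := S.exists_dist_le
  set v := volume.real (Metric.closedBall (0 : Plane) D) with hv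
  -- Balls of radius `D` about the rescaled points cover all tiles, whose total area is `λ^(2k)`.
  have hbound : ∀ k, (S.scale ^ k) ^ 2 ≤ Fintype.card (κ k) * v := by
    intro k
    have h1 : volume.real (S.cover (S.patch k)) = (S.scale ^ k) ^ 2 := by
      rw [cover_patch, volumeReal_smul]
      simp [Measure.real, hX]
    have h2 : S.cover (S.patch k) ⊆
        ⋃ a : κ k, Metric.closedBall (S.scale ^ k • (x k a : Plane)) D := by
      intro y hy
      obtain ⟨t, ht, hyt⟩ := Set.mem_iUnion₂.1 hy
      obtain ⟨a, ha⟩ := hcov k t ht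
      exact Set.mem_iUnion.2 ⟨a, hD t y hyt _ ha⟩
    have h3 : volume (⋃ a : κ k, Metric.closedBall (S.scale ^ k • (x k a : Plane)) D) ≠ ∞ :=
      (isCompact_iUnion fun a : κ k => isCompact_closedBall _ _).measure_lt_top.ne
    rw [← h1]
    refine (measureReal_mono h2 h3).trans ((measureReal_iUnion_fintype_le _).trans_eq ?_)
    simp [hv, Measure.real, Measure.addHaar_closedBall_center]
  have hvpos : 0 < v := by
    by_contra h
    have h1 := hbound 0
    have h2 : (Fintype.card (κ 0) : ℝ) * v ≤ 0 :=
      mul_nonpos_of_nonneg_of_nonpos (Nat.cast_nonneg _) (not_lt.1 h)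
    have h3 := S.sq_scale_pow_pos 0
    linarith
  refine ⟨v⁻¹, inv_pos.2 hvpos, fun k => ?_⟩
  rw [inv_mul_le_iff₀ hvpos, mul_comm v]
  exact hbound k

/-- Equidistribution of finite families of points in `X` whose numbers are controlled by a
subadditive quantity `N` from above and by an asymptotically equal quantity `I` from below. -/
theorem tendsto_averageDirac (hprim : S.IsPrimitive) (hX : volume S.X = 1) {κ : ℕ → Type*}
    [∀ k, Fintype (κ k)] [∀ k, Nonempty (κ k)] (x : ∀ k, κ k → S.X) {N I : ℕ → ι → ℝ}
    (hN : ∀ k i, 0 ≤ N k i)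
    (hsub : ∀ n k i, N (n + k) i ≤ ∑ t ∈ S.superTile n (proto i), N k t.label)
    (hNI : ∀ i, Tendsto (fun k => (N k i - I k i) / (S.scale ^ k) ^ 2) atTop (𝓝 0))
    (hcard : ∀ k, (Fintype.card (κ k) : ℝ) ≤ ∑ i, N k i)
    (hcov : ∀ k, ∀ t ∈ S.patch k, ∃ a, S.scale ^ k • (x k a : Plane) ∈ t.support S.tile)
    (hlow : ∀ n k, ∀ A ⊆ S.patch n, ∑ s ∈ A, I k s.label ≤
      Nat.card {a : κ (n + k) // S.scale ^ n • (x (n + k) a : Plane) ∈ S.cover A}) :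
    Tendsto (fun k => averageDirac (x k)) atTop (𝓝 (S.lebesgue hX)) := by
  classical
  obtain ⟨c, hc⟩ := S.exists_tendsto_of_subadditive hprim hN hsub
  have hcI : ∀ i, Tendsto (fun k => I k i / (S.scale ^ k) ^ 2) atTop (𝓝 (c * S.area i)) := by
    intro i
    have h1 := (hc i).sub (hNI i)
    rw [sub_zero] at h1
    refine h1.congr fun k => ?_
    ring
  have htot : Tendsto (fun k => (∑ i, N k i) / (S.scale ^ k) ^ 2) atTop (𝓝 c) := by
    have h1 := tendsto_finsetSum Finset.univ fun i _ => hc i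
    rw [← Finset.mul_sum, S.sum_area hX, mul_one] at h1
    simpa only [Finset.sum_div] using h1
  -- The constant is cancelled later, so degenerate growth must be excluded.
  have hcpos : 0 < c := by
    obtain ⟨η, hη, hηk⟩ := S.exists_card_lower_bound hX x hcov
    refine hη.trans_le (ge_of_tendsto' htot fun k => ?_)
    rw [le_div_iff₀ (S.sq_scale_pow_pos k)]
    exact (hηk k).trans (hcard k)
  obtain ⟨D, hD⟩ := S.exists_dist_le
  -- Portmanteau: lower bounds on open sets suffice for probability measures.
  refine tendsto_of_forall_isOpen_le_liminf_nat' fun G hG => ?_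
  obtain ⟨O, hO, rfl⟩ := hG
  refine le_of_forall_lt_imp_le_of_dense fun r hr => ?_
  have hr' : r < volume (S.X ∩ O) := by
    have h1 : (S.lebesgue hX : Measure S.X) (Subtype.val ⁻¹' O) = volume (S.X ∩ O) := by
      change Measure.comap (Subtype.val : S.X → Plane) volume _ = _
      rw [comap_subtype_coe_apply S.measurableSet_X, Subtype.image_preimage_coe]
    rwa [h1] at hr
  obtain ⟨K, hKXO, hK, hrK⟩ :=
    (S.measurableSet_X.inter hO.measurableSet).exists_lt_isCompact hr'
  obtain ⟨δ, hδ, hδO⟩ := hK.exists_thickening_subset_open hO (hKXO.trans Set.inter_subset_right)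
  -- At level `n` tiles have diameter below `δ`, so those meeting `K` lie inside `O` and belong to
  -- `A`.
  obtain ⟨n, hn⟩ := S.exists_div_scale_pow_lt D hδ
  have hpn := pow_pos S.scale_pos n
  set A := (S.patch n).filter fun t => ∀ y ∈ t.support S.tile, (S.scale ^ n)⁻¹ • y ∈ O with hA
  have hKA : S.scale ^ n • K ⊆ S.cover A := by
    rintro _ ⟨y, hy, rfl⟩
    have h1 : S.scale ^ n • y ∈ S.cover (S.patch n) := by
      rw [cover_patch]
      exact Set.smul_mem_smul_set (hKXO hy).1
    obtain ⟨t, ht, hyt⟩ := Set.mem_iUnion₂.1 h1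
    refine Set.mem_iUnion₂.2 ⟨t, Finset.mem_filter.2 ⟨ht, fun z hz => hδO ?_⟩, hyt⟩
    refine Metric.mem_thickening_iff.2 ⟨y, hy, lt_of_le_of_lt ?_ hn⟩
    rw [le_div_iff₀ hpn, mul_comm]
    have h2 := hD t z hz _ hyt
    rw [dist_eq_norm] at h2 ⊢
    have h3 : z - S.scale ^ n • y = S.scale ^ n • ((S.scale ^ n)⁻¹ • z - y) := by
      rw [smul_sub, smul_inv_smul₀ hpn.ne']
    rwa [h3, norm_smul, Real.norm_of_nonneg hpn.le] at h2
  have hKlt : r < ENNReal.ofReal ((∑ s ∈ A, S.area s.label) / (S.scale ^ n) ^ 2) := by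
    refine hrK.trans_le ?_
    rw [← ofReal_measureReal hK.measure_lt_top.ne]
    refine ENNReal.ofReal_le_ofReal ?_
    rw [le_div_iff₀ (S.sq_scale_pow_pos n), mul_comm, ← volumeReal_smul,
      ← S.volumeReal_cover ((S.isPacking_patch n).subset S (Finset.filter_subset _ _))]
    refine measureReal_mono hKA (IsCompact.measure_lt_top ?_).ne
    exact A.isCompact_biUnion fun t _ => t.isCompact_support S.tile
  -- Numerator and denominator grow with the same constant `c`, leaving the area of the level-`n`
  -- tiles in `A`.
  have hlimit : Tendsto (fun k => (∑ s ∈ A, I k s.label) / ∑ i, N (n + k) i) atTop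
      (𝓝 ((∑ s ∈ A, S.area s.label) / (S.scale ^ n) ^ 2)) := by
    have h1 := tendsto_finsetSum A fun s _ => hcI s.label
    have h2 : Tendsto (fun k => (∑ i, N (n + k) i) / (S.scale ^ (n + k)) ^ 2) atTop (𝓝 c) := by
      simpa only [add_comm n] using (tendsto_add_atTop_iff_nat n).2 htot
    have h3 := h1.div (h2.mul_const ((S.scale ^ n) ^ 2))
      (mul_pos hcpos (S.sq_scale_pow_pos n)).ne'
    rw [← Finset.mul_sum, mul_div_mul_left _ _ hcpos.ne'] at h3
    refine h3.congr fun k => ?_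
    simp only [Pi.div_apply]
    rw [← Finset.sum_div, pow_add, mul_pow]
    rw [mul_comm ((S.scale ^ n) ^ 2), div_mul_eq_mul_div, mul_div_mul_right _ _
      (S.sq_scale_pow_pos n).ne', div_div_div_cancel_right₀ (S.sq_scale_pow_pos k).ne']
  refine le_liminf_of_le (by isBoundedDefault) ?_
  have hev : ∀ᶠ k in atTop, r ≤ (averageDirac (x (n + k)) : Measure S.X) (Subtype.val ⁻¹' O) := by
    have h1 := (ENNReal.tendsto_ofReal hlimit).eventually_const_lt hKlt
    filter_upwards [h1] with k hk
    refine hk.le.trans ?_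
    rw [averageDirac_apply _ (hO.measurableSet.preimage measurable_subtype_coe)]
    refine ENNReal.ofReal_le_ofReal ?_
    have hcp : (0 : ℝ) < Fintype.card (κ (n + k)) := by exact_mod_cast Fintype.card_pos
    have h2 : ∑ s ∈ A, I k s.label ≤
        ((Finset.univ.filter fun a => x (n + k) a ∈ Subtype.val ⁻¹' O).card : ℝ) := by
      refine (hlow n k A (Finset.filter_subset _ _)).trans ?_
      rw [Nat.card_eq_fintype_card, Fintype.card_subtype]
      refine Nat.cast_le.2 (Finset.card_le_card fun a ha => ?_)
      rw [Finset.mem_filter] at ha ⊢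
      refine ⟨ha.1, ?_⟩
      obtain ⟨t, ht, hat⟩ := Set.mem_iUnion₂.1 ha.2
      have h3 := (Finset.mem_filter.1 ht).2 _ hat
      rwa [inv_smul_smul₀ hpn.ne'] at h3
    -- The points in `O` are bounded below through `I`, the total number above through `N`.
    exact (div_le_div_of_nonneg_right h2 (hcp.le.trans (hcard _))).trans
      (div_le_div_of_nonneg_left (Nat.cast_nonneg _) hcp (hcard _))
  simpa only [add_comm n] using (eventually_atTop.1 hev |>.elim fun k₀ hk₀ =>
    eventually_atTop.2 ⟨n + k₀, fun k hk => by
      obtain ⟨j, rfl⟩ := Nat.exists_eq_add_of_le (show n ≤ k by omega)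
      exact hk₀ j (by omega)⟩)

end PolygonSubstitution

/-! ### Families with a fixed number of points per tile. -/

namespace PolygonSubstitution

variable {ι : Type*} (S : PolygonSubstitution ι)

theorem sum_superTile_eq {M : Type*} [AddCommMonoid M] (w : ι → M) (k : ℕ) (t : Tile ι) :
    ∑ s ∈ S.superTile k t, w s.label = ∑ s ∈ S.superTile k (proto t.label), w s.label := by
  classical
  obtain ⟨g, hg⟩ := S.exists_superTile_eq_image k t
  rw [hg, Finset.sum_image fun _ _ _ _ h => Tile.map_injective g h]
  rfl

theorem smul_mem_support_of_mem_superTile {n k : ℕ} {s t : Tile ι} (ht : t ∈ S.superTile k s)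
    {y : Plane} (hy : S.scale ^ (n + k) • y ∈ t.support S.tile) :
    S.scale ^ n • y ∈ s.support S.tile := by
  have h1 := S.support_subset_of_mem_superTile ht hy
  rwa [pow_add, mul_comm, mul_smul,
    Set.smul_mem_smul_set_iff₀ (pow_ne_zero k S.scale_ne_zero)] at h1

/-- Equidistribution of families of points that contain a fixed positive number `w i` of points
for each tile of the label `i`. -/
theorem tendsto_averageDirac_of_card_fiber [Fintype ι] [Nonempty ι] (hprim : S.IsPrimitive)
    (hX : volume S.X = 1) {κ : ℕ → Type*} [∀ k, Fintype (κ k)] [∀ k, Nonempty (κ k)]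
    (x : ∀ k, κ k → S.X) (w : ι → ℕ) (hw : ∀ i, 0 < w i) (π : ∀ k, κ k → S.patch k)
    (hπ : ∀ k (t : S.patch k), Nat.card {a // π k a = t} = w t.1.label)
    (hx : ∀ k a, S.scale ^ k • (x k a : Plane) ∈ (π k a).1.support S.tile) :
    Tendsto (fun k => averageDirac (x k)) atTop (𝓝 (S.lebesgue hX)) := by
  classical
  have hfib : ∀ k (B : Finset (Tile ι)), B ⊆ S.patch k →
      ((Finset.univ.filter fun a => (π k a).1 ∈ B).card : ℕ) = ∑ t ∈ B, w t.label := by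
    intro k B hB
    rw [Finset.card_eq_sum_card_fiberwise (f := fun a => (π k a).1) (t := B)
      fun a ha => by simpa using ha]
    refine Finset.sum_congr rfl fun t ht => ?_
    rw [← hπ k ⟨t, hB ht⟩, Nat.card_eq_fintype_card, Fintype.card_subtype]
    congr 1
    ext a
    simp only [Finset.mem_filter, Finset.mem_univ, true_and, Subtype.ext_iff]
    exact ⟨fun h => h.2, fun h => ⟨h ▸ ht, h⟩⟩
  -- The weighted tile count is additive under subdivision, so it serves as both upper and lower
  -- count.
  refine S.tendsto_averageDirac hprim hX x
    (N := fun k i => ((∑ t ∈ S.superTile k (proto i), w t.label : ℕ) : ℝ))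
    (I := fun k i => ((∑ t ∈ S.superTile k (proto i), w t.label : ℕ) : ℝ))
    (fun k i => Nat.cast_nonneg _) (fun n k i => ?_) (fun i => by simp) (fun k => ?_)
    (fun k t ht => ?_) (fun n k A hA => ?_)
  · rw [← Nat.cast_sum]
    refine Nat.cast_le.2 ?_
    simp only [← S.sum_superTile_eq w k]
    rw [superTile_add, Finset.sum_biUnion ((S.isPacking_superTile n _).pairwiseDisjoint_superTile
      S k)]
  · rw [← Nat.cast_sum]
    refine Nat.cast_le.2 ?_
    have h1 := hfib k _ subset_rfl
    simp only [Finset.coe_mem, Finset.filter_true, Finset.card_univ] at h1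
    rw [h1, patch, iterate_eq_biUnion, Finset.sum_biUnion, Finset.sum_image]
    · intro i _ j _ hij
      exact congrArg Tile.label hij
    · exact (S.isPacking_patch 0).pairwiseDisjoint_superTile S k
  · have h1 : 0 < Nat.card {a // π k a = ⟨t, ht⟩} := by
      rw [hπ]
      exact hw _
    obtain ⟨⟨a, ha⟩⟩ := (Nat.card_pos_iff.1 h1).1
    refine ⟨a, ?_⟩
    have h2 := hx k a
    rwa [ha] at h2
  · rw [← Nat.cast_sum]
    refine Nat.cast_le.2 ?_
    simp only [← S.sum_superTile_eq w k]
    rw [← Finset.sum_biUnion (((S.isPacking_patch n).subset S hA).pairwiseDisjoint_superTile S k),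
      ← hfib (n + k), Nat.card_eq_fintype_card, Fintype.card_subtype]
    · refine Finset.card_le_card fun a ha => ?_
      rw [Finset.mem_filter] at ha ⊢
      obtain ⟨s, hs, has⟩ := Finset.mem_biUnion.1 ha.2
      exact ⟨ha.1, S.support_subset_cover hs (S.smul_mem_support_of_mem_superTile has (hx _ a))⟩
    · rw [patch_add]
      exact Finset.biUnion_subset_biUnion_of_subset_left _ hA

/-! ### Distinct vertices and the boundary estimate. -/

open Classical in
/-- The set of all vertices of the tiles of a patch. -/
noncomputable def vertexSet (Q : Finset (Tile ι)) : Finset Plane := Q.biUnion fun t => t.vertices S.tile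

theorem mem_vertexSet {Q : Finset (Tile ι)} {v : Plane} :
    v ∈ S.vertexSet Q ↔ ∃ t ∈ Q, v ∈ t.vertices S.tile := by
  simp [vertexSet]

theorem vertexSet_biUnion [DecidableEq (Tile ι)] [DecidableEq Plane] {α : Type*} (Q : Finset α)
    (f : α → Finset (Tile ι)) :
    S.vertexSet (Q.biUnion f) = Q.biUnion fun a => S.vertexSet (f a) := by
  ext v
  simp only [mem_vertexSet, Finset.mem_biUnion]
  grind

theorem vertexSet_image_map [DecidableEq (Tile ι)] [DecidableEq Plane] (g : Plane ≃ᵃⁱ[ℝ] Plane)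
    (Q : Finset (Tile ι)) :
    S.vertexSet (Q.image (Tile.map g)) = (S.vertexSet Q).image g := by
  ext v
  simp only [mem_vertexSet, Finset.mem_image, exists_exists_and_eq_and, Tile.map_vertices]
  grind

theorem vertexSet_subset_cover (Q : Finset (Tile ι)) : (S.vertexSet Q : Set Plane) ⊆ S.cover Q := by
  intro v hv
  obtain ⟨t, ht, hvt⟩ := S.mem_vertexSet.1 hv
  exact S.support_subset_cover ht (S.vertices_subset_support t hvt)

open Classical in
/-- The vertices of a patch that lie in the interior of the region which it covers. -/
noncomputable def innerVertexSet (Q : Finset (Tile ι)) : Finset Plane :=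
  (S.vertexSet Q).filter fun v => v ∈ interior (S.cover Q)

theorem card_vertexSet_superTile (k : ℕ) (t : Tile ι) :
    (S.vertexSet (S.superTile k t)).card = (S.vertexSet (S.superTile k (proto t.label))).card := by
  classical
  obtain ⟨g, hg⟩ := S.exists_superTile_eq_image k t
  rw [hg, vertexSet_image_map, Finset.card_image_of_injective _ g.injective]

theorem card_innerVertexSet_superTile (k : ℕ) (t : Tile ι) :
    (S.innerVertexSet (S.superTile k t)).card =
      (S.innerVertexSet (S.superTile k (proto t.label))).card := by
  classical
  obtain ⟨g, hg⟩ := S.exists_superTile_eq_image k t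
  rw [hg, innerVertexSet, innerVertexSet, vertexSet_image_map, cover_image_map,
    ← image_interior_affineIsometry, Finset.filter_image,
    Finset.card_image_of_injective _ g.injective]
  congr 1
  ext v
  simp

/-- Inner vertices of `ω^k(t)` lie in the interior of `λ^k t`, and these interiors are disjoint.
Inner counts can therefore be added without counting a point twice. -/
theorem IsPacking.pairwiseDisjoint_innerVertexSet {Q : Finset (Tile ι)} (hQ : S.IsPacking Q)
    (k : ℕ) :
    (Q : Set (Tile ι)).PairwiseDisjoint fun t => S.innerVertexSet (S.superTile k t) := by
  classical
  intro s hs t ht hst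
  rw [Function.onFun, Finset.disjoint_left]
  intro v hv hv'
  have h1 := (Finset.mem_filter.1 hv).2
  have h2 := (Finset.mem_filter.1 hv').2
  have hk := pow_ne_zero k S.scale_ne_zero
  rw [cover_superTile, interior_smul₀ hk, Set.mem_smul_set_iff_inv_smul_mem₀ hk] at h1 h2
  exact Set.disjoint_left.1 (hQ hs ht hst) h1 h2

variable [Fintype ι]

/-- A vertex that is not inner lies on the boundary of the inflated prototile. The tiles meeting
that boundary stay within distance `D` of it, so an area comparison bounds their number. -/
theorem card_vertexSet_sub_card_innerVertexSet_le [Nonempty ι] : ∃ C D : ℝ, ∀ i k,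
    ((S.vertexSet (S.superTile k (proto i))).card : ℝ) -
      (S.innerVertexSet (S.superTile k (proto i))).card ≤
    C * ((S.scale ^ k) ^ 2 *
      volume.real (Metric.cthickening (D / S.scale ^ k) (frontier (S.tile i).carrier))) := by
  classical
  obtain ⟨D, hD⟩ := S.exists_dist_le
  obtain ⟨a, ha⟩ := Finite.exists_min S.area
  obtain ⟨b, hb⟩ := Finite.exists_max fun i => (S.tile i).n
  -- The largest number of vertices of a tile over the smallest area.
  refine ⟨(S.tile b).n / S.area a, D, fun i k => ?_⟩
  have hk := pow_pos S.scale_pos k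
  set Q := S.superTile k (proto i) with hQ
  have hcov : S.cover Q = S.scale ^ k • (S.tile i).carrier := by
    rw [hQ, cover_superTile, Tile.proto_support]
  set T := Q.filter fun t => ∃ v ∈ t.support S.tile, (S.scale ^ k)⁻¹ • v ∈
    frontier (S.tile i).carrier with hT
  have h1 : (S.vertexSet Q).card ≤ (S.innerVertexSet Q).card + (S.vertexSet T).card := by
    refine (Finset.card_le_card fun v hv => ?_).trans (Finset.card_union_le _ _)
    by_cases hvi : v ∈ interior (S.cover Q)
    · exact Finset.mem_union_left _ (Finset.mem_filter.2 ⟨hv, hvi⟩)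
    · refine Finset.mem_union_right _ ?_
      obtain ⟨t, ht, hvt⟩ := S.mem_vertexSet.1 hv
      have hvs := S.vertices_subset_support t hvt
      refine S.mem_vertexSet.2 ⟨t, Finset.mem_filter.2 ⟨ht, v, hvs, ?_⟩, hvt⟩
      have h2 := S.support_subset_cover ht hvs
      rw [hcov, Set.mem_smul_set_iff_inv_smul_mem₀ hk.ne'] at h2
      rw [hcov, interior_smul₀ hk.ne', Set.mem_smul_set_iff_inv_smul_mem₀ hk.ne'] at hvi
      rw [(S.tile i).isRegion.isCompact.isClosed.frontier_eq]
      exact ⟨h2, hvi⟩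
  have h2 : (S.vertexSet T).card ≤ T.card * (S.tile b).n := by
    refine Finset.card_biUnion_le_card_mul _ _ _ fun t _ => ?_
    rw [Tile.card_vertices]
    exact hb _
  have h3 : T.card * S.area a ≤ volume.real (S.cover T) := by
    rw [S.volumeReal_cover ((S.isPacking_superTile k _).subset S (Finset.filter_subset _ _)),
      ← nsmul_eq_mul]
    exact Finset.card_nsmul_le_sum _ _ _ fun t _ => ha _
  have h4 : S.cover T ⊆
      S.scale ^ k • Metric.cthickening (D / S.scale ^ k) (frontier (S.tile i).carrier) := by
    intro y hy
    obtain ⟨t, ht, hyt⟩ := Set.mem_iUnion₂.1 hy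
    obtain ⟨v, hv, hvf⟩ := (Finset.mem_filter.1 ht).2
    rw [Set.mem_smul_set_iff_inv_smul_mem₀ hk.ne']
    refine Metric.mem_cthickening_of_dist_le _ _ _ _ hvf ?_
    rw [dist_smul₀, Real.norm_of_nonneg (inv_pos.2 hk).le, inv_mul_eq_div]
    exact div_le_div_of_nonneg_right (hD t y hyt v hv) hk.le
  have hFc : IsCompact (frontier (S.tile i).carrier) :=
    (S.tile i).isRegion.isCompact.of_isClosed_subset isClosed_frontier
      (S.tile i).isRegion.isCompact.isClosed.frontier_subset
  have h5 := measureReal_mono (μ := volume) h4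
    (hFc.cthickening.smul _).measure_lt_top.ne
  rw [volumeReal_smul] at h5
  have h6 : ((S.vertexSet Q).card : ℝ) ≤ (S.innerVertexSet Q).card + T.card * (S.tile b).n := by
    exact_mod_cast h1.trans (Nat.add_le_add_left h2 _)
  have h7 : (T.card : ℝ) * (S.tile b).n ≤
      (S.tile b).n / S.area a * volume.real (S.cover T) := by
    rw [div_mul_eq_mul_div, le_div_iff₀ (S.area_pos a), mul_comm (T.card : ℝ), mul_assoc]
    exact mul_le_mul_of_nonneg_left h3 (Nat.cast_nonneg _)
  have h8 := mul_le_mul_of_nonneg_left h5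
    (div_nonneg (Nat.cast_nonneg (S.tile b).n) (S.area_pos a).le)
  linarith

/-- Closed neighbourhoods of the compact frontier shrink to it, so their areas tend to its area,
which is zero. -/
theorem tendsto_card_vertexSet_sub_card_innerVertexSet [Nonempty ι] (i : ι) :
    Tendsto (fun k => (((S.vertexSet (S.superTile k (proto i))).card : ℝ) -
      (S.innerVertexSet (S.superTile k (proto i))).card) / (S.scale ^ k) ^ 2) atTop (𝓝 0) := by
  classical
  obtain ⟨C, D, hCD⟩ := S.card_vertexSet_sub_card_innerVertexSet_le
  have hFc : IsCompact (frontier (S.tile i).carrier) :=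
    (S.tile i).isRegion.isCompact.of_isClosed_subset isClosed_frontier
      (S.tile i).isRegion.isCompact.isClosed.frontier_subset
  have h1 : Tendsto (fun n : ℕ => D / S.scale ^ n) atTop (𝓝 0) :=
    (tendsto_pow_atTop_atTop_of_one_lt S.one_lt_scale).const_div_atTop D
  have h2 := ((ENNReal.tendsto_toReal (by simp [(S.tile i).volume_frontier])).comp
    ((tendsto_measure_cthickening_of_isCompact (μ := volume) hFc).comp h1)).const_mul C
  rw [(S.tile i).volume_frontier, ENNReal.toReal_zero, mul_zero] at h2
  refine squeeze_zero (fun k => ?_) (fun k => ?_) h2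
  · exact div_nonneg (sub_nonneg.2 (Nat.cast_le.2 (Finset.card_filter_le _ _)))
      (S.sq_scale_pow_pos k).le
  · rw [div_le_iff₀ (S.sq_scale_pow_pos k)]
    refine (hCD i k).trans_eq ?_
    simp only [Function.comp, Measure.real]
    ring

theorem mem_levelVertices {k : ℕ} {y : S.X} :
    y ∈ S.levelVertices k ↔ S.scale ^ k • (y : Plane) ∈ S.vertexSet (S.patch k) := by
  have hk := pow_ne_zero k S.scale_ne_zero
  simp only [levelVertices, levelVertex, Finset.mem_image, Finset.mem_univ, true_and,
    mem_vertexSet, Subtype.ext_iff]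
  constructor
  · rintro ⟨⟨⟨t, ht⟩, ⟨v, hv⟩⟩, h⟩
    refine ⟨t, ht, ?_⟩
    rw [← h, smul_inv_smul₀ hk]
    exact hv
  · rintro ⟨t, ht, hv⟩
    exact ⟨⟨⟨t, ht⟩, ⟨_, hv⟩⟩, inv_smul_smul₀ hk _⟩

/-- Every vertex of the patch `ω^k(P)` comes from a point of level `k`. -/
theorem exists_mem_levelVertices {k : ℕ} {v : Plane} (hv : v ∈ S.vertexSet (S.patch k)) :
    ∃ y ∈ S.levelVertices k, S.scale ^ k • (y : Plane) = v := by
  have hk := pow_ne_zero k S.scale_ne_zero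
  have h1 := S.vertexSet_subset_cover _ hv
  rw [cover_patch, Set.mem_smul_set_iff_inv_smul_mem₀ hk] at h1
  refine ⟨⟨_, h1⟩, S.mem_levelVertices.2 ?_, smul_inv_smul₀ hk _⟩
  simpa only [smul_inv_smul₀ hk] using hv

theorem card_levelVertices (k : ℕ) :
    (S.levelVertices k).card = (S.vertexSet (S.patch k)).card := by
  refine Finset.card_bij (fun y _ => S.scale ^ k • (y : Plane))
    (fun y hy => S.mem_levelVertices.1 hy) (fun y _ z _ h => ?_)
    (fun v hv => by simpa using S.exists_mem_levelVertices hv)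
  exact Subtype.ext (smul_right_injective _ (pow_ne_zero k S.scale_ne_zero) h)

/-! ### The three limits. -/

variable [Nonempty ι]

theorem tendsto_xi (hprim : S.IsPrimitive) (hX : volume S.X = 1) :
    Tendsto S.xi atTop (𝓝 (S.lebesgue hX)) :=
  S.tendsto_averageDirac_of_card_fiber hprim hX S.levelPuncture (fun _ => 1) (fun _ => one_pos)
    (fun _ t => t) (fun k t => by simp) fun k t => by
      simpa only [levelPuncture, smul_inv_smul₀ (pow_ne_zero k S.scale_ne_zero)] using
        S.puncture_mem_support t.1

theorem tendsto_rho (hprim : S.IsPrimitive) (hX : volume S.X = 1) :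
    Tendsto S.rho atTop (𝓝 (S.lebesgue hX)) := by
  refine S.tendsto_averageDirac_of_card_fiber hprim hX S.levelVertex (fun i => (S.tile i).n)
    (fun i => zero_lt_three.trans_le (S.tile i).isRegion.isSimple.1) (fun k v => v.1)
    (fun k t => ?_) fun k v => ?_
  · rw [← t.1.card_vertices S.tile, Nat.card_congr (Equiv.sigmaSubtype t)]
    simp
  · simpa only [levelVertex, smul_inv_smul₀ (pow_ne_zero k S.scale_ne_zero)] using
      S.vertices_subset_support v.1.1 v.2.2

theorem tendsto_sigma (hprim : S.IsPrimitive) (hX : volume S.X = 1) :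
    Tendsto S.sigma atTop (𝓝 (S.lebesgue hX)) := by
  classical
  refine S.tendsto_averageDirac hprim hX (fun k (y : S.levelVertices k) => (y : S.X))
    (N := fun k i => ((S.vertexSet (S.superTile k (proto i))).card : ℝ))
    (I := fun k i => ((S.innerVertexSet (S.superTile k (proto i))).card : ℝ))
    (fun k i => Nat.cast_nonneg _) (fun n k i => ?_)
    S.tendsto_card_vertexSet_sub_card_innerVertexSet (fun k => ?_) (fun k t ht => ?_)
    (fun n k A hA => ?_)
  · simp only [← S.card_vertexSet_superTile k]
    rw [superTile_add, vertexSet_biUnion]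
    exact_mod_cast Finset.card_biUnion_le
  · rw [Fintype.card_coe, card_levelVertices, patch_eq_biUnion, vertexSet_biUnion]
    exact_mod_cast Finset.card_biUnion_le
  · obtain ⟨v, hv⟩ := S.vertices_nonempty t
    obtain ⟨y, hy, rfl⟩ := S.exists_mem_levelVertices (S.mem_vertexSet.2 ⟨t, ht, hv⟩)
    exact ⟨⟨y, hy⟩, S.vertices_subset_support t hv⟩
  · simp only [← S.card_innerVertexSet_superTile k]
    rw [← Nat.cast_sum, Nat.card_eq_fintype_card, Fintype.card_subtype, ← Finset.card_biUnion
      (((S.isPacking_patch n).subset S hA).pairwiseDisjoint_innerVertexSet S k)]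
    -- Each inner vertex of `ω^k(s)` with `s ∈ A` is the rescaling of a level-`(n + k)` vertex
    -- which, at the scale of level `n`, lies in `s`.
    refine Nat.cast_le.2 (Finset.card_le_card_of_surjOn
      (fun y : S.levelVertices (n + k) => S.scale ^ (n + k) • (y : Plane)) fun v hv => ?_)
    obtain ⟨s, hs, hv⟩ := Finset.mem_biUnion.1 (Finset.mem_coe.1 hv)
    obtain ⟨t, ht, hvt⟩ := S.mem_vertexSet.1 (Finset.mem_filter.1 hv).1
    have htp : t ∈ S.patch (n + k) := by
      rw [patch_add]
      exact Finset.mem_biUnion.2 ⟨s, hA hs, ht⟩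
    obtain ⟨y, hy, rfl⟩ := S.exists_mem_levelVertices (S.mem_vertexSet.2 ⟨t, htp, hvt⟩)
    refine ⟨⟨y, hy⟩, ?_, rfl⟩
    simp only [Finset.coe_filter, Finset.mem_univ, true_and, Set.mem_ofPred_eq]
    exact S.support_subset_cover hs
      (S.smul_mem_support_of_mem_superTile ht (S.vertices_subset_support t hvt))

end PolygonSubstitution

theorem theorem1 {ι : Type*} [Fintype ι] [Nonempty ι] (S : PolygonSubstitution ι)
    (hprim : S.IsPrimitive) (hX : volume S.X = 1) :
    Tendsto S.xi atTop (𝓝 (S.lebesgue hX)) ∧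
    Tendsto S.rho atTop (𝓝 (S.lebesgue hX)) ∧
    Tendsto S.sigma atTop (𝓝 (S.lebesgue hX)) :=
  ⟨S.tendsto_xi hprim hX, S.tendsto_rho hprim hX, S.tendsto_sigma hprim hX⟩
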